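/- An $i$-hedrite is a finite $2$-connected $4$-valent plane graph (multiple edges allowed) whose faces, the exterior face included, are all $2$-, $3$- or $4$-gons, and which has exactly $8-i$ faces that are $2$-gons. A central circuit is a closed walk obtained by starting with an edge and continuing at each vertex by the edge opposite to the entering one; it is simple if it passes through no vertex twice. Two central circuits are disjoint if they have no common vertex. A ring of $4$-gons is a cyclic sequence of pairwise distinct $4$-gonal faces in which every face is adjacent to the preceding one and to the following one on opposite edges. It separates two central circuits if neither of them uses an edge shared by consecutive faces of the ring and the two circuits lie in different components of the sphere minus the open ring (the open faces of the ring together with the open edges shared by consecutive faces), so that the circuits may lie on the boundary of the ring. Let $C_1$ and $C_2$ be any two central circuits of an $i$-hedrite. Then $C_1$ and $C_2$ are disjoint if and only if both $C_1$ and $C_2$ are simple and there exists a ring of $4$-gons separating them. -/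

import Mathlib

/-- A finite graph (loops and multiple edges allowed) drawn on an oriented closed surface, as a
combinatorial map (rotation system).  A dart is an edge with one of its two directions.  `vert d`
is the next dart, counterclockwise, with the same initial vertex as `d`; `edge d` is the reversed
dart. -/
structure CombMap (D : Type*) where
  vert : Equiv.Perm D
  edge : Equiv.Perm D
  edge_edge : ∀ d, edge (edge d) = d
  edge_ne : ∀ d, edge d ≠ d

namespace CombMap

variable {D : Type*} (M : CombMap D)

/-- The next dart along the boundary of the face to the left of a dart: go to the end of the dart
and turn left as sharply as possible. -/
def face : Equiv.Perm D := M.vert⁻¹ * M.edge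

/-- Continue along the opposite edge: enter the end vertex of the dart through `edge d`, and leave
it two places further in the rotation (opposite, if the vertex has degree four). -/
def straight : Equiv.Perm D := M.vert * M.vert * M.edge

/-- If the face to the left of `d` is a `4`-gon, cross this face from its edge `d` to the opposite
edge `face (face d)`; the result is that edge, directed so that the next face is on its left. -/
def across : Equiv.Perm D := M.edge * M.face * M.face

/-- The vertices, edges and faces are the cycles (fixed points included) of the three
permutations. -/
def Vertex : Type _ := Quotient (Equiv.Perm.SameCycle.setoid M.vert)

/-- See `Vertex`. -/
def Edge : Type _ := Quotient (Equiv.Perm.SameCycle.setoid M.edge)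

/-- See `Vertex`. -/
def Face : Type _ := Quotient (Equiv.Perm.SameCycle.setoid M.face)

/-- The two darts start at the same vertex. -/
def SameVertex (d e : D) : Prop := M.vert.SameCycle d e

/-- The two darts have the same face on their left. -/
def SameFace (d e : D) : Prop := M.face.SameCycle d e

/-- Degree of the initial vertex of a dart (a loop counts twice). -/
noncomputable def degree (d : D) : ℕ := {e | M.SameVertex d e}.ncard

/-- Number of sides of the face to the left of a dart. -/
noncomputable def faceSize (d : D) : ℕ := {e | M.SameFace d e}.ncard

/-- `p k` is the number of `k`-gonal faces. -/
noncomputable def p (k : ℕ) : ℕ :=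
  {F : M.Face | ∃ d : D, Quotient.mk (Equiv.Perm.SameCycle.setoid M.face) d = F ∧
    M.faceSize d = k}.ncard

/-- The initial vertices of `d` and `e` are joined by a path in the graph that uses no edge
having one of its two darts in `A`. -/
def JoinedOff (A : Set D) : D → D → Prop :=
  Relation.ReflTransGen fun d e =>
    M.SameVertex d e ∨ (d ∉ A ∧ M.edge d ∉ A ∧ e = M.edge d)

/-- The graph is connected (and not empty). -/
def Connected : Prop := Nonempty D ∧ ∀ d e, M.JoinedOff ∅ d e

/-- The graph is connected, and remains so after the removal of any vertex `v` (given by a dart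
that starts there) with all edges at `v`. -/
def TwoConnected : Prop :=
  M.Connected ∧ ∀ v d e, ¬ M.SameVertex v d → ¬ M.SameVertex v e →
    M.JoinedOff {x | M.SameVertex v x} d e

/-- The map is a connected plane graph, equivalently a connected graph on the sphere:
the Euler characteristic is `2`.  The exterior face counts as a face. -/
def IsPlane : Prop :=
  M.Connected ∧ Nat.card M.Vertex + Nat.card M.Face = Nat.card M.Edge + 2

/-- An `i`-hedrite: a `2`-connected `4`-valent plane graph, all faces of which are `2`-, `3`- or
`4`-gons, with `p 2 = 8 - i`. -/
structure IsHedrite (i : ℕ) : Prop where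
  isPlane : M.IsPlane
  twoConnected : M.TwoConnected
  fourValent : ∀ d, M.degree d = 4
  faceSize_mem : ∀ d, M.faceSize d = 2 ∨ M.faceSize d = 3 ∨ M.faceSize d = 4
  p_two : M.p 2 + i = 8

/-- `C` is the set of darts, in both directions, of the edges of a central circuit: the circuit
obtained by starting with some dart `d` and always continuing along the opposite edge. -/
def IsCentralCircuit (C : Set D) : Prop :=
  ∃ d, C = {e | M.straight.SameCycle d e ∨ M.straight.SameCycle d (M.edge e)}

/-- The central circuit `C` of a `4`-valent graph has no self-intersection: there is no vertex all
four edge ends of which belong to `C`. -/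
def IsSimple (C : Set D) : Prop := ∀ d, ∃ e, M.SameVertex d e ∧ e ∉ C

/-- The circuits `C₁` and `C₂` have no common vertex (hence no common edge). -/
def DisjointCircuits (C₁ C₂ : Set D) : Prop :=
  ∀ d ∈ C₁, ∀ e ∈ C₂, ¬ M.SameVertex d e

/-- A ring of `4`-gons: a cyclic sequence of pairwise distinct `4`-gonal faces, in which each face
is adjacent to the preceding one and to the following one on opposite edges.  It is given by the
set `R` of the edges between consecutive faces, each one directed so that the following face is
on its left. -/
def IsRing (R : Set D) : Prop :=
  (∃ d, R = {e | M.across.SameCycle d e}) ∧ (∀ d ∈ R, M.faceSize d = 4) ∧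
    ∀ d ∈ R, ∀ e ∈ R, M.SameFace d e → d = e

/-- The ring `R` separates `C₁` from `C₂`: neither circuit runs through the ring, and they lie in
different components of the complement of the (open) ring.  A face that is not in the ring has none
of the edges in `R` on its boundary, so the boundary of the face is joined in the graph without
these edges: the components of the complement of the ring on the surface correspond to those of the
graph without the edges in `R`. -/
def Separates (R C₁ C₂ : Set D) : Prop :=
  (∀ d ∈ C₁ ∪ C₂, d ∉ R) ∧ ∀ d ∈ C₁, ∀ e ∈ C₂, ¬ M.JoinedOff R d e

end CombMap

/-! If a ring separates the circuits, they cannot share a vertex: two darts at one vertex are joined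
off any set of edges.

Conversely, let `A` be the union of two disjoint circuits. A path between them, cut down to meet
each only at an end (`exists_reflTransGen_between`), runs in one region `T` of faces bounded by
edges of `A`. Since `T` touches both circuits, its open part has Euler characteristic at most `0`.
This is a dimension count over `ZMod 2` (`card_cycleReps_add_card_cycleReps_le`,
`flat_of_disjoint`): coboundaries of functions on inner vertices, one extra cochain telling the two
circuits apart, and differences of functions on faces are orthogonal families. By a combinatorial
Gauss-Bonnet formula (`flat_of_card_le`), four times this characteristic is the sum of `4 -
faceSize` over the faces of `T` plus the number of corners of `T`. All terms are nonnegative, so all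
vanish: `T` consists of `4`-gons and has no corner.

Without corners, following a circuit straight ahead keeps `T` on the same side, and a
self-intersection would be a corner; so both circuits are simple. The faces of `T` along `C₁` form a
ring (`across_invariant`, `isRing_of_flat`). Planarity gives a `ZMod 2` potential that jumps exactly
at the ring edges (`exists_ring_potential`); the path from `C₁` to `C₂` uses a ring edge only at its
start, so the potential differs on the two circuits. -/

namespace CombMap

/-! ### Cycles of a permutation and sums over them -/

section Cycles

variable {D : Type*}

/-- On a finite set every element of a cycle is reached by nonnegative powers, so forward invariance
suffices. -/
theorem mem_of_sameCycle [Finite D] {σ : Equiv.Perm D} {S : Set D} (hS : ∀ x ∈ S, σ x ∈ S)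
    {x y : D} (h : σ.SameCycle x y) (hx : x ∈ S) : y ∈ S := by
  obtain ⟨n, rfl⟩ := h.exists_nat_pow_eq
  induction n with
  | zero => simpa using hx
  | succ n ih =>
    rw [pow_succ', Equiv.Perm.mul_apply]
    exact hS _ (ih ⟨n, by simp⟩)

theorem mem_of_apply_mem [Finite D] {σ : Equiv.Perm D} {S : Set D} (hS : ∀ x ∈ S, σ x ∈ S)
    {x : D} (h : σ x ∈ S) : x ∈ S :=
  mem_of_sameCycle hS (Equiv.Perm.sameCycle_apply_left.2 (Equiv.Perm.SameCycle.refl σ x)) h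

theorem eq_of_sameCycle {K : Type*} {σ : Equiv.Perm D} {g : D → K} (hg : ∀ x, g (σ x) = g x)
    {x y : D} (h : σ.SameCycle x y) : g x = g y := by
  obtain ⟨n, rfl⟩ := h
  induction n using Int.induction_on with
  | zero => simp
  | succ n ih => rw [add_comm, zpow_add, Equiv.Perm.mul_apply, zpow_one, hg, ← ih]
  | pred n ih =>
    rw [ih, sub_eq_neg_add, zpow_add, Equiv.Perm.mul_apply, zpow_neg_one, ← hg (σ⁻¹ _)]
    simp

theorem pow_ncard_sameCycle [Finite D] (σ : Equiv.Perm D) (x : D) :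
    (σ ^ {e | σ.SameCycle x e}.ncard) x = x := by
  classical
  have := Fintype.ofFinite D
  have h : σ.IsCycleOn (Finset.univ.filter fun e => σ.SameCycle x e : Finset D) := by
    refine ⟨⟨fun y hy => ?_, σ.injective.injOn, fun y hy => ⟨σ⁻¹ y, ?_, by simp⟩⟩,
      fun y hy z hz => ?_⟩
    · simpa using hy
    · simpa using hy
    · simp only [Finset.coe_filter, Finset.mem_univ, true_and, Set.mem_ofPred_eq] at hy hz
      exact hy.symm.trans hz
  have h2 := h.pow_card_apply (a := x) (by simp [Equiv.Perm.SameCycle.refl])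
  rwa [← Set.ncard_coe_finset, Finset.coe_filter_univ] at h2

/-- A representative of the cycle of `x`, the same for all elements of this cycle. -/
noncomputable def cycleRep (σ : Equiv.Perm D) (x : D) : D :=
  Quotient.out (Quotient.mk (Equiv.Perm.SameCycle.setoid σ) x)

theorem sameCycle_cycleRep (σ : Equiv.Perm D) (x : D) : σ.SameCycle (cycleRep σ x) x :=
  Quotient.exact (s := Equiv.Perm.SameCycle.setoid σ) (Quotient.out_eq _)

theorem cycleRep_eq_iff {σ : Equiv.Perm D} {x y : D} :
    cycleRep σ x = cycleRep σ y ↔ σ.SameCycle x y := by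
  refine ⟨fun h => (sameCycle_cycleRep σ x).symm.trans (h ▸ sameCycle_cycleRep σ y), fun h => ?_⟩
  unfold cycleRep
  rw [Quotient.sound (s := Equiv.Perm.SameCycle.setoid σ) h]

theorem cycleRep_cycleRep (σ : Equiv.Perm D) (x : D) :
    cycleRep σ (cycleRep σ x) = cycleRep σ x :=
  cycleRep_eq_iff.2 (sameCycle_cycleRep σ x)

theorem cycleRep_apply (σ : Equiv.Perm D) (x : D) : cycleRep σ (σ x) = cycleRep σ x :=
  cycleRep_eq_iff.2 (Equiv.Perm.sameCycle_apply_left.2 (Equiv.Perm.SameCycle.refl σ x))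

theorem cycleRep_mem [Finite D] {σ : Equiv.Perm D} {S : Set D} (hS : ∀ x ∈ S, σ x ∈ S) {x : D} :
    cycleRep σ x ∈ S ↔ x ∈ S :=
  ⟨mem_of_sameCycle hS (sameCycle_cycleRep σ x), mem_of_sameCycle hS (sameCycle_cycleRep σ x).symm⟩

variable [Fintype D]

open Classical in
/-- The representatives of the cycles in an invariant set. -/
noncomputable def cycleReps (σ : Equiv.Perm D) (S : Set D) : Finset D :=
  Finset.univ.filter fun x => x ∈ S ∧ cycleRep σ x = x

theorem mem_cycleReps {σ : Equiv.Perm D} {S : Set D} {x : D} :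
    x ∈ cycleReps σ S ↔ x ∈ S ∧ cycleRep σ x = x := by
  simp [cycleReps]

theorem cycleRep_mem_cycleReps {σ : Equiv.Perm D} {S : Set D} (hS : ∀ x ∈ S, σ x ∈ S) {x : D} :
    cycleRep σ x ∈ cycleReps σ S ↔ x ∈ S := by
  rw [mem_cycleReps, cycleRep_mem hS]
  simp [cycleRep_cycleRep]

open Classical in
theorem sum_cycleReps {K : Type*} [AddCommMonoid K] {σ : Equiv.Perm D} {S : Set D}
    (hS : ∀ x ∈ S, σ x ∈ S) (φ : D → K) :
    ∑ x with x ∈ S, φ x = ∑ r ∈ cycleReps σ S, ∑ x with σ.SameCycle r x, φ x := by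
  rw [← Finset.sum_fiberwise_of_maps_to (t := cycleReps σ S) (g := cycleRep σ)]
  · refine Finset.sum_congr rfl fun r hr => Finset.sum_congr ?_ fun _ _ => rfl
    rw [mem_cycleReps] at hr
    ext x
    simp only [Finset.mem_filter, Finset.mem_univ, true_and]
    constructor
    · rintro ⟨-, rfl⟩
      exact sameCycle_cycleRep σ x
    · intro h
      exact ⟨mem_of_sameCycle hS h hr.1, by rw [← hr.2]; exact (cycleRep_eq_iff.2 h).symm⟩
  · intro x hx
    rw [cycleRep_mem_cycleReps hS]
    simpa using hx

theorem ncard_eq_sum_cycleReps {σ : Equiv.Perm D} {S : Set D} (hS : ∀ x ∈ S, σ x ∈ S) :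
    S.ncard = ∑ r ∈ cycleReps σ S, {e | σ.SameCycle r e}.ncard := by
  classical
  have h := sum_cycleReps hS (fun _ => 1)
  simp only [Finset.sum_const, smul_eq_mul, mul_one] at h
  rw [← Set.ncard_coe_finset] at h
  simp only [← Set.ncard_coe_finset] at h
  simpa using h

theorem card_quotient_eq_card_cycleReps (σ : Equiv.Perm D) :
    Nat.card (Quotient (Equiv.Perm.SameCycle.setoid σ)) = (cycleReps σ Set.univ).card := by
  rw [← Nat.card_eq_finsetCard]
  refine Nat.card_congr (Equiv.ofBijective (fun q => ⟨q.out, ?_⟩) ⟨fun q q' h => ?_, fun x => ?_⟩)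
  · rw [mem_cycleReps]
    refine ⟨trivial, ?_⟩
    unfold cycleRep
    rw [Quotient.out_eq]
  · simpa using h
  · exact ⟨Quotient.mk _ x.1, Subtype.ext (mem_cycleReps.1 x.2).2⟩

end Cycles

/-! ### Orthogonality of vertex and face cochains over `ZMod 2` -/

section Duality

theorem rank_toMatrix'_of_injective {N γ K : Type*} [Fintype N] [Fintype γ] [DecidableEq γ]
    [Field K] (L : (γ → K) →ₗ[K] (N → K)) (hL : ∀ c, L c = 0 → c = 0) :
    (LinearMap.toMatrix' L).rank = Fintype.card γ := by
  rw [Matrix.rank, ← Matrix.toLin'_apply', Matrix.toLin'_toMatrix',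
    LinearMap.finrank_range_of_inj ((injective_iff_map_eq_zero L).2 hL),
    Module.finrank_fintype_fun_eq_card]

theorem card_add_card_le_of_orthogonal {N α β K : Type*} [Fintype N] [Fintype α] [Fintype β]
    [Field K] (P : (α → K) →ₗ[K] (N → K)) (Q : (β → K) →ₗ[K] (N → K))
    (hP : ∀ a, P a = 0 → a = 0) (hQ : ∀ b, Q b = 0 → b = 0)
    (h : ∀ a b, ∑ n, P a n * Q b n = 0) :
    Fintype.card α + Fintype.card β ≤ Fintype.card N := by
  classical
  rw [← rank_toMatrix'_of_injective P hP, ← rank_toMatrix'_of_injective Q hQ,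
    ← Matrix.rank_transpose]
  apply Matrix.rank_add_rank_le_card_of_mul_eq_zero
  ext a b
  simpa [Matrix.mul_apply, LinearMap.toMatrix'_apply] using h (Pi.single a 1) (Pi.single b 1)

variable {D : Type*}

open Classical in
/-- Extend a function on cycle representatives to a function that is constant on cycles, and `0`
on the cycles without a given value. -/
noncomputable def extendCycles (K : Type*) [Semiring K] (σ : Equiv.Perm D) (P : Finset D) :
    (P → K) →ₗ[K] (D → K) where
  toFun c x := if h : cycleRep σ x ∈ P then c ⟨_, h⟩ else 0
  map_add' c c' := by
    ext x
    by_cases h : cycleRep σ x ∈ P <;> simp [h]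
  map_smul' a c := by
    ext x
    by_cases h : cycleRep σ x ∈ P <;> simp [h]

theorem extendCycles_apply_self (K : Type*) [Semiring K] {σ : Equiv.Perm D} {P : Finset D}
    (c : P → K) {x : P} (hx : cycleRep σ x = x) : extendCycles K σ P c x = c x := by
  simp [extendCycles, hx]

theorem extendCycles_apply_perm (K : Type*) [Semiring K] (σ : Equiv.Perm D) (P : Finset D)
    (c : P → K) (x : D) : extendCycles K σ P c (σ x) = extendCycles K σ P c x := by
  classical
  exact congrArg (fun y => if h : y ∈ P then c ⟨y, h⟩ else 0) (cycleRep_apply σ x)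

theorem extendCycles_of_notMem (K : Type*) [Semiring K] {σ : Equiv.Perm D} {P : Finset D}
    (c : P → K) {x : D} (hx : cycleRep σ x ∉ P) : extendCycles K σ P c x = 0 := by
  simp [extendCycles, hx]

variable (M : CombMap D)

theorem vert_face (x : D) : M.vert (M.face x) = M.edge x := by simp [face]

theorem sameCycle_edge_iff [Finite D] {x y : D} : M.edge.SameCycle x y ↔ y = x ∨ y = M.edge x := by
  constructor
  · intro h
    exact mem_of_sameCycle (S := {y | y = x ∨ y = M.edge x})
      (by rintro z (rfl | rfl) <;> simp [M.edge_edge]) h (Or.inl rfl)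
  · rintro (rfl | rfl)
    · exact Equiv.Perm.SameCycle.refl _ _
    · exact Equiv.Perm.sameCycle_apply_right.2 (Equiv.Perm.SameCycle.refl _ _)

open Classical in
theorem sum_cycleReps_edge [Fintype D] {K : Type*} [AddCommMonoid K] {S : Set D}
    (hS : ∀ x ∈ S, M.edge x ∈ S) (φ : D → K) :
    ∑ x with x ∈ S, φ x = ∑ r ∈ cycleReps M.edge S, (φ r + φ (M.edge r)) := by
  rw [sum_cycleReps hS]
  refine Finset.sum_congr rfl fun r _ => ?_
  rw [← Finset.sum_pair (M.edge_ne r).symm]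
  refine Finset.sum_congr ?_ fun _ _ => rfl
  ext x
  simp [sameCycle_edge_iff]

variable [Fintype D]

-- Discrete Stokes: since `vert (face x) = edge x`, reindexing by `face` turns the second summand
-- into the first, and the two cancel mod `2`. The excluded terms vanish anyway.
open Classical in
theorem sum_coboundary_mul_eq_zero {T A : Set D} {g h : D → ZMod 2}
    (hg : ∀ x, g (M.vert x) = g x) (hh : ∀ x, h (M.face x) = h x)
    (hgA : ∀ x ∈ A, g (M.edge x) = g x) (hT : ∀ x ∉ T, h x = 0) :
    ∑ x with x ∈ T \ A, (g x + g (M.edge x)) * h x = 0 := by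
  calc ∑ x with x ∈ T \ A, (g x + g (M.edge x)) * h x
      = ∑ x, (g x + g (M.edge x)) * h x := by
        refine Finset.sum_subset (Finset.subset_univ _) fun x _ hx => ?_
        simp only [Finset.mem_filter, Finset.mem_univ, true_and, Set.mem_sdiff, not_and,
          not_not] at hx
        by_cases hxT : x ∈ T
        · rw [hgA x (hx hxT), CharTwo.add_self_eq_zero, zero_mul]
        · rw [hT x hxT, mul_zero]
    _ = ∑ x, g x * h x + ∑ x, g (M.face x) * h (M.face x) := by
        rw [← Finset.sum_add_distrib]
        refine Finset.sum_congr rfl fun x _ => ?_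
        rw [hh, ← M.vert_face x, hg]
        ring
    _ = 0 := by
        rw [Equiv.sum_comp M.face fun x => g x * h x, CharTwo.add_self_eq_zero]

-- An upper bound for the Euler characteristic of `T`. The vertices in `U` together with the extra
-- cochain `r` span dimension `|V'| + 1`; the faces span `|F| - 1`, because only constants have zero
-- difference across all inner edges. The two spaces are orthogonal in the space of inner edges, and
-- the `+1` and `-1` cancel.
open Classical in
theorem card_cycleReps_add_card_cycleReps_le {T A U : Set D} {r : D → ZMod 2} {x₀ : D}
    (hx₀ : x₀ ∈ T) (hA : ∀ x ∈ A, M.edge x ∈ A) (hTf : ∀ x ∈ T, M.face x ∈ T)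
    (hTe : ∀ x ∈ T, x ∉ A → M.edge x ∈ T) (hU : ∀ x ∈ U, M.vert x ∈ U) (hUA : ∀ x ∈ U, x ∉ A)
    (hr : ∀ x, r (M.edge x) = r x)
    (orth : ∀ h : D → ZMod 2, (∀ x, h (M.face x) = h x) → (∀ x ∉ T, h x = 0) →
      ∑ x with x ∈ T \ A, r x * h x = 0)
    (inj : ∀ g : D → ZMod 2, (∀ x, g (M.vert x) = g x) → (∀ x ∉ U, g x = 0) → ∀ c,
      (∀ x ∈ T \ A, g x + g (M.edge x) + c * r x = 0) → c = 0 ∧ ∀ x, g x = 0)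
    (conn : ∀ h : D → ZMod 2, (∀ x, h (M.face x) = h x) →
      (∀ x ∈ T \ A, h (M.edge x) = h x) → ∀ x ∈ T, h x = h x₀) :
    (cycleReps M.vert U).card + (cycleReps M.face T).card ≤
      (cycleReps M.edge (T \ A)).card := by
  set V' := cycleReps M.vert U
  set F' := (cycleReps M.face T).erase (cycleRep M.face x₀) with hF'
  set N := cycleReps M.edge (T \ A) with hN
  have hNe : ∀ x ∈ T \ A, M.edge x ∈ T \ A := fun x hx =>
    ⟨hTe x hx.1 hx.2, fun h => hx.2 (M.edge_edge x ▸ hA _ h)⟩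
  have symm_zero : ∀ s : D → ZMod 2, (∀ x, s (M.edge x) = s x) → (∀ n : N, s n = 0) →
      ∀ x ∈ T \ A, s x = 0 := fun s hs h x hx => by
    rw [← eq_of_sameCycle hs (sameCycle_cycleRep M.edge x)]
    exact h ⟨_, (cycleRep_mem_cycleReps hNe).2 hx⟩
  let δ : (D → ZMod 2) →ₗ[ZMod 2] (N → ZMod 2) :=
    { toFun := fun g n => g n + g (M.edge n)
      map_add' := fun g g' => by ext n; simp; ring
      map_smul' := fun a g => by ext n; simp; ring }
  let ρ : ZMod 2 →ₗ[ZMod 2] (N → ZMod 2) :=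
    { toFun := fun c n => c * r n
      map_add' := fun c c' => by ext n; simp; ring
      map_smul' := fun a c => by ext n; simp; ring }
  let P : (V' ⊕ Unit → ZMod 2) →ₗ[ZMod 2] (N → ZMod 2) :=
    (δ ∘ₗ extendCycles (ZMod 2) M.vert V') ∘ₗ LinearMap.funLeft (ZMod 2) (ZMod 2) Sum.inl +
      ρ ∘ₗ LinearMap.proj (Sum.inr ())
  let Q : (F' → ZMod 2) →ₗ[ZMod 2] (N → ZMod 2) := δ ∘ₗ extendCycles (ZMod 2) M.face F'
  have hPapp : ∀ a n, P a n = extendCycles (ZMod 2) M.vert V' (a ∘ Sum.inl) n +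
      extendCycles (ZMod 2) M.vert V' (a ∘ Sum.inl) (M.edge n) + a (Sum.inr ()) * r n :=
    fun a n => rfl
  have hQapp : ∀ b n, Q b n = extendCycles (ZMod 2) M.face F' b n +
      extendCycles (ZMod 2) M.face F' b (M.edge n) := fun b n => rfl
  have hsuppU : ∀ c : V' → ZMod 2, ∀ x ∉ U, extendCycles (ZMod 2) M.vert V' c x = 0 :=
    fun c x hx => extendCycles_of_notMem _ _ (mt (cycleRep_mem_cycleReps hU).1 hx)
  have hsuppT : ∀ c : F' → ZMod 2, ∀ x ∉ T, extendCycles (ZMod 2) M.face F' c x = 0 :=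
    fun c x hx => extendCycles_of_notMem _ _ fun h =>
      hx ((cycleRep_mem_cycleReps hTf).1 (Finset.mem_of_mem_erase h))
  have key := card_add_card_le_of_orthogonal P Q ?_ ?_ ?_
  · have h1 : cycleRep M.face x₀ ∈ cycleReps M.face T := (cycleRep_mem_cycleReps hTf).2 hx₀
    have h2 := Finset.card_erase_add_one h1
    simp only [Fintype.card_sum, Fintype.card_coe, Fintype.card_unit] at key
    rw [← hF'] at h2
    omega
  · intro a ha
    obtain ⟨hc, hg⟩ := inj (extendCycles (ZMod 2) M.vert V' (a ∘ Sum.inl))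
      (extendCycles_apply_perm _ _ _ _) (hsuppU _) (a (Sum.inr ()))
      (symm_zero (fun x => extendCycles (ZMod 2) M.vert V' (a ∘ Sum.inl) x +
        extendCycles (ZMod 2) M.vert V' (a ∘ Sum.inl) (M.edge x) + a (Sum.inr ()) * r x)
        (fun x => by simp only [M.edge_edge, hr]; ring)
        (fun n => by rw [← hPapp, ha, Pi.zero_apply]))
    ext (v | u)
    · have := extendCycles_apply_self (ZMod 2) (a ∘ Sum.inl) (mem_cycleReps.1 v.2).2
      rw [hg] at this
      exact this.symm
    · exact hc
  · intro b hb
    have h1 := conn (extendCycles (ZMod 2) M.face F' b) (extendCycles_apply_perm _ _ _ _)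
      (fun x hx => by
        have := symm_zero (fun x => extendCycles (ZMod 2) M.face F' b x +
          extendCycles (ZMod 2) M.face F' b (M.edge x))
          (fun x => by simp only [M.edge_edge]; ring)
          (fun n => by rw [← hQapp, hb, Pi.zero_apply]) x hx
        exact (CharTwo.add_eq_zero.1 this).symm)
    have h2 : extendCycles (ZMod 2) M.face F' b x₀ = 0 :=
      extendCycles_of_notMem _ _ (by simp [hF'])
    ext f
    have hf := mem_cycleReps.1 (Finset.mem_of_mem_erase f.2)
    rw [← extendCycles_apply_self (ZMod 2) b hf.2, h1 _ hf.1, h2]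
    rfl
  · intro a b
    set g := extendCycles (ZMod 2) M.vert V' (a ∘ Sum.inl) with hg
    set h := extendCycles (ZMod 2) M.face F' b with hh
    set c := a (Sum.inr ())
    have hgA : ∀ x ∈ A, g x = 0 := fun x hx => hsuppU _ x fun hxU => hUA x hxU hx
    have hgv : ∀ x, g (M.vert x) = g x := extendCycles_apply_perm _ _ _ _
    have hhf : ∀ x, h (M.face x) = h x := extendCycles_apply_perm _ _ _ _
    -- The vertex side is symmetric under `edge`, so the sum over edges unfolds to one over darts,
    -- where `h` occurs alone.
    calc ∑ n, P a n * Q b n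
        = ∑ n ∈ N, ((g n + g (M.edge n) + c * r n) * h n +
            (g (M.edge n) + g (M.edge (M.edge n)) + c * r (M.edge n)) * h (M.edge n)) := by
          rw [← Finset.sum_coe_sort N]
          refine Finset.sum_congr rfl fun n _ => ?_
          rw [hPapp, hQapp, M.edge_edge, hr, ← hg, ← hh]
          ring
      _ = ∑ x with x ∈ T \ A, (g x + g (M.edge x) + c * r x) * h x :=
          by convert! (M.sum_cycleReps_edge hNe
            fun x => (g x + g (M.edge x) + c * r x) * h x).symm
      _ = ∑ x with x ∈ T \ A, (g x + g (M.edge x)) * h x +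
            c * ∑ x with x ∈ T \ A, r x * h x := by
          rw [Finset.mul_sum, ← Finset.sum_add_distrib]
          exact Finset.sum_congr rfl fun x _ => by ring
      _ = ∑ x with x ∈ T \ A, (g x + g (M.edge x)) * h x := by
          rw [orth h hhf (hsuppT b), mul_zero, add_zero]
      _ = 0 := M.sum_coboundary_mul_eq_zero hgv hhf (fun x hx => by rw [hgA x hx, hgA _ (hA x hx)])
          (hsuppT b)

end Duality
-- Potentials on plane graphs; regions and their curvature
section Regions

variable {D : Type*} (M : CombMap D)

theorem JoinedOff.apply_eq {K : Type*} {M : CombMap D} {A : Set D} {f : D → K}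
    (hv : ∀ x, f (M.vert x) = f x) (he : ∀ x, x ∉ A → M.edge x ∉ A → f (M.edge x) = f x) {d e : D}
    (h : M.JoinedOff A d e) : f d = f e := by
  induction h with
  | refl => rfl
  | tail _ h ih =>
    rw [ih]
    rcases h with h | ⟨h1, h2, rfl⟩
    · exact eq_of_sameCycle hv h
    · exact (he _ h1 h2).symm

theorem vert_vert_vert_vert [Finite D] (h4 : ∀ d, M.degree d = 4) (x : D) :
    M.vert (M.vert (M.vert (M.vert x))) = x := by
  have h := pow_ncard_sameCycle M.vert x
  rw [show {e | M.vert.SameCycle x e}.ncard = 4 from h4 x] at h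
  exact h

theorem face_face_face_face [Finite D] {x : D} (hx : M.faceSize x = 4) :
    M.face (M.face (M.face (M.face x))) = x := by
  have h := pow_ncard_sameCycle M.face x
  rw [show {e | M.face.SameCycle x e}.ncard = 4 from hx] at h
  exact h

theorem vert_inv_edge (x : D) : M.vert⁻¹ (M.edge x) = M.face x := rfl

theorem face_edge (x : D) : M.face (M.edge x) = M.vert⁻¹ x := by
  rw [← vert_inv_edge, M.edge_edge]

/-- A cochain on the edges of a plane graph that vanishes on the boundary of every face is the
coboundary of a function on the vertices. -/
theorem exists_potential [Fintype D] (hM : M.IsPlane) {r : D → ZMod 2}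
    (hr : ∀ x, r (M.edge x) = r x)
    (orth : ∀ h : D → ZMod 2, (∀ x, h (M.face x) = h x) → ∑ x, r x * h x = 0) :
    ∃ f : D → ZMod 2, (∀ x, f (M.vert x) = f x) ∧ ∀ x, f x + f (M.edge x) = r x := by
  classical
  -- If `r` were no coboundary it could serve as the extra cochain. With all vertices but one in
  -- `U`, the count would give `V - 1 + F ≤ E`, against Euler's `V + F = E + 2`.
  by_contra! hno
  obtain ⟨⟨⟨x₀⟩, hconn⟩, heuler⟩ := hM
  have const : ∀ f : D → ZMod 2, (∀ x, f (M.vert x) = f x) → (∀ x, f (M.edge x) = f x) →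
      ∀ x, f x = f x₀ := fun f hv he x => ((hconn x₀ x).apply_eq hv fun y _ _ => he y).symm
  set U : Set D := {x | ¬ M.SameVertex x₀ x} with hUdef
  have hU : ∀ x ∈ U, M.vert x ∈ U := fun x hx h =>
    hx (Equiv.Perm.sameCycle_apply_right.1 h)
  have key := M.card_cycleReps_add_card_cycleReps_le (T := Set.univ) (A := ∅) (U := U) (r := r)
    (x₀ := x₀) trivial (by simp) (by simp) (by simp) hU (by simp) hr ?_ ?_ ?_
  · have hV : cycleReps M.vert U = (cycleReps M.vert Set.univ).erase (cycleRep M.vert x₀) := by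
      ext x
      rw [Finset.mem_erase, mem_cycleReps, mem_cycleReps, hUdef, Set.mem_ofPred_eq, SameVertex,
        ← cycleRep_eq_iff]
      constructor
      · rintro ⟨h1, h2⟩
        exact ⟨fun h => h1 (by rw [h, cycleRep_cycleRep]), trivial, h2⟩
      · rintro ⟨h1, -, h2⟩
        exact ⟨fun h => h1 (by rw [h, h2]), h2⟩
    have hV1 : cycleRep M.vert x₀ ∈ cycleReps M.vert Set.univ :=
      (cycleRep_mem_cycleReps (by simp)).2 trivial
    have hV2 := Finset.card_erase_add_one hV1
    unfold Vertex Edge Face at heuler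
    rw [card_quotient_eq_card_cycleReps, card_quotient_eq_card_cycleReps,
      card_quotient_eq_card_cycleReps] at heuler
    rw [hV, Set.sdiff_empty] at key
    omega
  · intro h hh _
    simpa using orth h hh
  · intro g hg hgU c hc
    simp only [Set.sdiff_empty, Set.mem_univ, true_implies] at hc
    have hc0 : c = 0 := by
      by_contra hc0
      have hc1 : c = 1 := Fin.eq_one_of_ne_zero c hc0
      obtain ⟨x, hx⟩ := hno g hg
      refine hx (CharTwo.add_eq_zero.1 ?_)
      simpa [hc1] using hc x
    refine ⟨hc0, fun x => ?_⟩
    rw [const g hg (fun x => ?_) x]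
    · exact hgU _ fun h => h (Equiv.Perm.SameCycle.refl _ _)
    · have := hc x
      rw [hc0, zero_mul, add_zero] at this
      exact (CharTwo.add_eq_zero.1 this).symm
  · intro h hf he x _
    simp only [Set.sdiff_empty, Set.mem_univ, true_implies] at he
    refine const h (fun y => ?_) he x
    have := hf (M.edge y)
    rw [face_edge, he] at this
    rw [← he (M.vert y), ← hf, face_edge]
    simp

/-- The darts with a left face that can be reached from the left face of `d` by crossing edges
not in `A`. -/
def region (A : Set D) (d : D) : Set D :=
  {x | Relation.ReflTransGen (fun x y => y = M.face x ∨ (x ∉ A ∧ y = M.edge x)) d x}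

variable {M} {A : Set D} {d : D}

theorem self_mem_region : d ∈ M.region A d := Relation.ReflTransGen.refl

theorem face_mem_region {x : D} (h : x ∈ M.region A d) : M.face x ∈ M.region A d :=
  Relation.ReflTransGen.tail h (Or.inl rfl)

theorem edge_mem_region {x : D} (h : x ∈ M.region A d) (hx : x ∉ A) : M.edge x ∈ M.region A d :=
  Relation.ReflTransGen.tail h (Or.inr ⟨hx, rfl⟩)

theorem apply_eq_of_mem_region {K : Type*} {f : D → K}
    (hf : ∀ x ∈ M.region A d, f (M.face x) = f x)
    (he : ∀ x ∈ M.region A d, x ∉ A → f (M.edge x) = f x) {x : D} (h : x ∈ M.region A d) :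
    f x = f d := by
  induction h with
  | refl => rfl
  | tail hab h ih =>
    rcases h with rfl | ⟨h, rfl⟩
    · rw [hf _ hab, ih]
    · rw [he _ hab h, ih]

theorem vert_inv_mem_region {x : D} (h : x ∈ M.region A d) (hx : x ∉ A) :
    M.vert⁻¹ x ∈ M.region A d :=
  face_edge M x ▸ face_mem_region (edge_mem_region h hx)

theorem vert_mem_region [Finite D] (hA : ∀ x ∈ A, M.edge x ∈ A) {x : D}
    (h : x ∈ M.region A d) (hx : M.vert x ∉ A) : M.vert x ∈ M.region A d := by
  have h1 : M.edge (M.vert x) ∈ M.region A d := by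
    refine mem_of_apply_mem (σ := M.face) (fun _ => face_mem_region) ?_
    rw [face_edge]
    simpa using h
  rw [← M.edge_edge (M.vert x)]
  exact edge_mem_region h1 fun h => hx (M.edge_edge (M.vert x) ▸ hA _ h)

/-- The darts that start at a vertex of `C`, if `C` is closed under `vert * vert` (opposite darts at a vertex of degree four). -/
def atVertices (M : CombMap D) (C : Set D) : Set D := {x | x ∈ C ∨ M.vert x ∈ C}

theorem vert_mem_atVertices {C : Set D} (hC : ∀ x ∈ C, M.vert (M.vert x) ∈ C) :
    ∀ x ∈ M.atVertices C, M.vert x ∈ M.atVertices C := by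
  rintro x (h | h)
  · exact Or.inr (hC _ h)
  · exact Or.inl h

theorem vert_mem_compl_atVertices [Finite D] {C : Set D} (hC : ∀ x ∈ C, M.vert (M.vert x) ∈ C) :
    ∀ x ∉ M.atVertices C, M.vert x ∉ M.atVertices C :=
  fun _ hx h => hx (mem_of_apply_mem (vert_mem_atVertices hC) h)

theorem vert_mem_atVertices_iff [Finite D] {C : Set D} (hC : ∀ x ∈ C, M.vert (M.vert x) ∈ C)
    (x : D) : M.vert x ∈ M.atVertices C ↔ x ∈ M.atVertices C :=
  ⟨fun h => mem_of_apply_mem (vert_mem_atVertices hC) h, vert_mem_atVertices hC x⟩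

/-- A region has nonnegative curvature in total; if its Euler characteristic is at most `0`, it is
a union of `4`-gons, and there are no corners on its boundary. -/
theorem flat_of_card_le [Fintype D] (h4 : ∀ d, M.degree d = 4) (hs : ∀ d, M.faceSize d ≤ 4)
    (hA : ∀ x ∈ A, M.edge x ∈ A) (hA2 : ∀ x ∈ A, M.vert (M.vert x) ∈ A)
    (h : (cycleReps M.vert (M.region A d \ M.atVertices A)).card +
      (cycleReps M.face (M.region A d)).card ≤ (cycleReps M.edge (M.region A d \ A)).card) :
    (∀ x ∈ M.region A d, M.faceSize x = 4) ∧ ∀ x ∈ M.region A d, x ∈ A → M.vert x ∉ A := by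
  set T := M.region A d with hT
  have hU : ∀ x ∈ T \ M.atVertices A, M.vert x ∈ T \ M.atVertices A := fun x hx =>
    ⟨vert_mem_region hA hx.1 fun h => hx.2 (Or.inr h), vert_mem_compl_atVertices hA2 x hx.2⟩
  have hNe : ∀ x ∈ T \ A, M.edge x ∈ T \ A := fun x hx =>
    ⟨edge_mem_region hx.1 hx.2, fun h => hx.2 (M.edge_edge x ▸ hA _ h)⟩
  have cU : (T \ M.atVertices A).ncard = (cycleReps M.vert (T \ M.atVertices A)).card * 4 := by
    rw [ncard_eq_sum_cycleReps hU]
    exact Finset.sum_const_nat fun x _ => h4 x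
  have cN : (T \ A).ncard = (cycleReps M.edge (T \ A)).card * 2 := by
    rw [ncard_eq_sum_cycleReps hNe]
    refine Finset.sum_const_nat fun x _ => ?_
    simp only [sameCycle_edge_iff]
    exact Set.ncard_pair (M.edge_ne x).symm
  have cT : T.ncard = ∑ x ∈ cycleReps M.face T, M.faceSize x :=
    ncard_eq_sum_cycleReps fun _ => face_mem_region
  have cT4 : ∑ x ∈ cycleReps M.face T, M.faceSize x ≤ ∑ x ∈ cycleReps M.face T, 4 :=
    Finset.sum_le_sum fun x _ => hs x
  have cT4' : ∑ x ∈ cycleReps M.face T, 4 = (cycleReps M.face T).card * 4 := by simp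
  set B := T ∩ A
  -- `B` holds the boundary darts of the region, `B0` its corners.
  set B0 := {x ∈ B | M.vert x ∈ A} with hB0
  have cB : B.ncard + (T \ A).ncard = T.ncard := Set.ncard_inter_add_ncard_sdiff_eq_ncard _ _
  have cB0 : B0.ncard + (B \ B0).ncard = B.ncard := by
    rw [add_comm]
    exact Set.ncard_sdiff_add_ncard_of_subset fun x hx => hx.1
  have cV : (T ∩ M.atVertices A).ncard + (T \ M.atVertices A).ncard = T.ncard :=
    Set.ncard_inter_add_ncard_sdiff_eq_ncard _ _
  have hunion : T ∩ M.atVertices A = B ∪ M.vert '' (B \ B0) := by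
    ext x
    constructor
    · rintro ⟨hx, hxA⟩
      by_cases hx1 : x ∈ A
      · exact Or.inl ⟨hx, hx1⟩
      · refine Or.inr ⟨M.vert⁻¹ x, ⟨⟨vert_inv_mem_region hx hx1, ?_⟩, ?_⟩, by simp⟩
        · refine mem_of_apply_mem (σ := M.vert * M.vert) hA2 ?_
          simpa using hxA.resolve_left hx1
        · rintro ⟨-, h⟩
          exact hx1 (by simpa using h)
    · rintro (hx | ⟨y, ⟨hy, hy0⟩, rfl⟩)
      · exact ⟨hx.1, Or.inl hx.2⟩
      · exact ⟨vert_mem_region hA hy.1 fun h => hy0 ⟨hy, h⟩, Or.inr (hA2 _ hy.2)⟩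
  have hdisj : Disjoint B (M.vert '' (B \ B0)) := by
    rw [Set.disjoint_left]
    rintro _ hx ⟨y, ⟨hy, hy0⟩, rfl⟩
    exact hy0 ⟨hy, hx.2⟩
  have cV2 : (T ∩ M.atVertices A).ncard = B.ncard + (B \ B0).ncard := by
    rw [hunion, Set.ncard_union_eq hdisj, Set.ncard_image_of_injective _ M.vert.injective]
  -- With `V`, `E`, `F` counting the inner vertices, inner edges and faces, the counts combine to `4
  -- * (V - E + F) = ∑ (4 - faceSize) + B0.ncard`. The left side is at most `0`, the right side a
  -- sum of nonnegative terms.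
  constructor
  · intro x hx
    have hsum : ∑ x ∈ cycleReps M.face T, M.faceSize x = ∑ x ∈ cycleReps M.face T, 4 := by omega
    have hx' := (Finset.sum_eq_sum_iff_of_le fun x _ => hs x).1 hsum _
      ((cycleRep_mem_cycleReps fun _ => face_mem_region).2 hx)
    rw [← hx', faceSize, faceSize]
    congr 1
    ext y
    have h1 := sameCycle_cycleRep M.face x
    exact ⟨fun h => h1.trans h, fun h => h1.symm.trans h⟩
  · intro x hx hxA hvx
    have h0 : B0 = ∅ := by
      rw [← Set.ncard_eq_zero]
      omega
    exact Set.notMem_empty x (h0 ▸ (⟨⟨hx, hxA⟩, hvx⟩ : x ∈ B0))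

/-- The extra cochain is the coboundary of the indicator `k` of the vertices of `C₁`. It is
independent of the inner coboundaries because the region meets both circuits. -/
theorem flat_of_disjoint [Fintype D] (h4 : ∀ d, M.degree d = 4) (hs : ∀ d, M.faceSize d ≤ 4)
    {C₁ C₂ : Set D} (h1e : ∀ x ∈ C₁, M.edge x ∈ C₁) (h2e : ∀ x ∈ C₂, M.edge x ∈ C₂)
    (h1v : ∀ x ∈ C₁, M.vert (M.vert x) ∈ C₁) (h2v : ∀ x ∈ C₂, M.vert (M.vert x) ∈ C₂)
    (hdis : ∀ x ∈ M.atVertices C₁, x ∉ M.atVertices C₂)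
    {e₀ e₁ : D} (h0 : e₀ ∈ M.atVertices C₁) (h1 : e₁ ∈ M.region (C₁ ∪ C₂) e₀)
    (h2 : e₁ ∈ M.atVertices C₂) :
    (∀ x ∈ M.region (C₁ ∪ C₂) e₀, M.faceSize x = 4) ∧
      ∀ x ∈ M.region (C₁ ∪ C₂) e₀, x ∈ C₁ ∪ C₂ → M.vert x ∉ C₁ ∪ C₂ := by
  classical
  set A := C₁ ∪ C₂ with hAdef
  have hA : ∀ x ∈ A, M.edge x ∈ A := fun x hx => hx.imp (h1e x) (h2e x)
  have hA2 : ∀ x ∈ A, M.vert (M.vert x) ∈ A := fun x hx => hx.imp (h1v x) (h2v x)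
  refine flat_of_card_le h4 hs hA hA2 ?_
  have hsub1 : M.atVertices C₁ ⊆ M.atVertices A := fun x hx => hx.imp Or.inl Or.inl
  have hsub2 : M.atVertices C₂ ⊆ M.atVertices A := fun x hx => hx.imp Or.inr Or.inr
  let k : D → ZMod 2 := fun x => if x ∈ M.atVertices C₁ then 1 else 0
  have hk1 : ∀ x ∈ M.atVertices C₁, k x = 1 := fun x hx => if_pos hx
  have hk0 : ∀ x ∉ M.atVertices C₁, k x = 0 := fun x hx => if_neg hx
  have hkv : ∀ x, k (M.vert x) = k x := fun x => by
    simp only [k, vert_mem_atVertices_iff h1v]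
  have hkA : ∀ x ∈ A, k (M.edge x) = k x := by
    rintro x (hx | hx)
    · rw [hk1 x (Or.inl hx), hk1 _ (Or.inl (h1e x hx))]
    · rw [hk0 x fun h => hdis x h (Or.inl hx), hk0 _ fun h => hdis _ h (Or.inl (h2e x hx))]
  refine M.card_cycleReps_add_card_cycleReps_le (r := fun x => k x + k (M.edge x))
    self_mem_region hA (fun _ => face_mem_region) (fun _ => edge_mem_region) ?_ ?_ ?_ ?_ ?_ ?_
  · exact fun x hx =>
      ⟨vert_mem_region hA hx.1 fun h => hx.2 (Or.inr h), vert_mem_compl_atVertices hA2 x hx.2⟩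
  · exact fun x hx h => hx.2 (Or.inl h)
  · intro x
    rw [M.edge_edge, add_comm]
  · intro h hh hT
    exact M.sum_coboundary_mul_eq_zero hkv hh hkA hT
  · intro g hg hgU c hc
    -- A linear relation makes `f` constant on the region; it equals `c` at `e₀` and `0` at `e₁`, so
    -- `c = 0`, and then `g = 0`.
    let f : D → ZMod 2 := fun x => g x + c * k x
    have hfv : ∀ x, f (M.vert x) = f x := fun x => by simp only [f, hg, hkv]
    have hfe : ∀ x ∈ M.region A e₀, f (M.edge x) = f x := by
      intro x hx
      by_cases hxA : x ∈ A
      · simp only [f]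
        rw [hkA x hxA, hgU x fun h => h.2 (Or.inl hxA), hgU _ fun h => h.2 (Or.inl (hA x hxA))]
      · refine (CharTwo.add_eq_zero.1 ?_).symm
        rw [← hc x ⟨hx, hxA⟩]
        simp only [f]
        ring
    have hff : ∀ x ∈ M.region A e₀, f (M.face x) = f x := fun x hx => by
      rw [← hfv, M.vert_face, hfe x hx]
    have hconst : ∀ x ∈ M.region A e₀, f x = f e₀ := fun x =>
      apply_eq_of_mem_region hff fun x hx _ => hfe x hx
    have hf0 : f e₀ = c := by
      simp only [f]
      rw [hk1 _ h0, hgU _ fun h => h.2 (hsub1 h0), zero_add, mul_one]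
    have hf1 : f e₁ = 0 := by
      simp only [f]
      rw [hk0 _ fun h => hdis _ h h2, hgU _ fun h => h.2 (hsub2 h2), mul_zero, zero_add]
    have hc0 : c = 0 := by rw [← hf0, ← hconst _ h1, hf1]
    refine ⟨hc0, fun x => ?_⟩
    by_cases hx : x ∈ M.region A e₀
    · have hfx : f x = 0 := (hconst x hx).trans (hf0.trans hc0)
      simpa [f, hc0] using hfx
    · exact hgU x fun h => hx h.1
  · intro h hf he x hx
    exact apply_eq_of_mem_region (fun x _ => hf x) (fun x hx hxA => he x ⟨hx, hxA⟩) hx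

end Regions
-- Restart the path at each visit to `V₁`, and stop at the first visit to `V₂` after that.
theorem exists_reflTransGen_between {D : Type*} {r : D → D → Prop} {V₁ V₂ : Set D} {a b : D}
    (h : Relation.ReflTransGen r a b) (ha : a ∈ V₁) (hb : b ∈ V₂) :
    ∃ a' ∈ V₁, ∃ b' ∈ V₂,
      Relation.ReflTransGen (fun x y => x ∉ V₂ ∧ y ∉ V₁ ∧ r x y) a' b' := by
  by_contra! hno
  suffices ∀ x, Relation.ReflTransGen r a x → ∃ a' ∈ V₁,
      Relation.ReflTransGen (fun x y => x ∉ V₂ ∧ y ∉ V₁ ∧ r x y) a' x by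
    obtain ⟨a', ha', h'⟩ := this b h
    exact hno a' ha' b hb h'
  intro x hx
  induction hx with
  | refl => exact ⟨a, ha, .refl⟩
  | @tail y z _ hyz ih =>
    obtain ⟨a', ha', h'⟩ := ih
    by_cases hz : z ∈ V₁
    · exact ⟨z, hz, .refl⟩
    · exact ⟨a', ha', h'.tail ⟨fun hy => hno a' ha' y hy h', hz, hyz⟩⟩

/-! ### Central circuits along a flat region -/

section Circuits

variable {D : Type*} {M : CombMap D} {C : Set D}

theorem IsCentralCircuit.edge_mem (hC : M.IsCentralCircuit C) : ∀ x ∈ C, M.edge x ∈ C := by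
  obtain ⟨d, rfl⟩ := hC
  rintro x (h | h)
  · exact Or.inr (by rwa [M.edge_edge])
  · exact Or.inl h

theorem sameVertex_vert (M : CombMap D) (x : D) : M.SameVertex x (M.vert x) :=
  Equiv.Perm.sameCycle_apply_right.2 (Equiv.Perm.SameCycle.refl _ _)

theorem sameVertex_of_atVertices {x : D} {C : Set D} (hx : x ∈ M.atVertices C) :
    ∃ y ∈ C, M.SameVertex x y := by
  rcases hx with h | h
  · exact ⟨x, h, Equiv.Perm.SameCycle.refl _ _⟩
  · exact ⟨_, h, M.sameVertex_vert x⟩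

variable [Finite D]

theorem JoinedOff.reflTransGen {d e : D} (h : M.JoinedOff ∅ d e) :
    Relation.ReflTransGen (fun x y => y = M.vert x ∨ y = M.edge x) d e := by
  induction h with
  | refl => exact .refl
  | @tail y z _ hyz ih =>
    rcases hyz with h | ⟨-, -, rfl⟩
    · exact mem_of_sameCycle
        (S := {z | Relation.ReflTransGen (fun x y => y = M.vert x ∨ y = M.edge x) d z})
        (fun x hx => hx.tail (Or.inl rfl)) h ih
    · exact ih.tail (Or.inr rfl)

/-- Conjugation by `edge` inverts `straight`: a central circuit can be run backwards. -/
theorem straight_edge_straight (h4 : ∀ d, M.degree d = 4) (x : D) :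
    M.straight (M.edge (M.straight x)) = M.edge x := by
  simp only [straight, Equiv.Perm.mul_apply, M.edge_edge, M.vert_vert_vert_vert h4]

theorem vert_inv_vert_inv_edge (h4 : ∀ d, M.degree d = 4) (x : D) :
    M.vert⁻¹ (M.vert⁻¹ (M.edge x)) = M.straight x := by
  rw [Equiv.Perm.inv_eq_iff_eq, Equiv.Perm.inv_eq_iff_eq]
  exact (M.vert_vert_vert_vert h4 _).symm

theorem sameCycle_edge_edge (h4 : ∀ d, M.degree d = 4) {d e : D}
    (h : M.straight.SameCycle d e) : M.straight.SameCycle (M.edge d) (M.edge e) := by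
  refine mem_of_sameCycle (S := {e | M.straight.SameCycle (M.edge d) (M.edge e)})
    (fun x hx => ?_) h (Equiv.Perm.SameCycle.refl _ _)
  rw [Set.mem_ofPred_eq] at hx ⊢
  rwa [← Equiv.Perm.sameCycle_apply_right, straight_edge_straight h4]

theorem IsCentralCircuit.sameCycle (h4 : ∀ d, M.degree d = 4) (hC : M.IsCentralCircuit C)
    {a e : D} (ha : a ∈ C) (he : e ∈ C) :
    M.straight.SameCycle a e ∨ M.straight.SameCycle a (M.edge e) := by
  obtain ⟨d, rfl⟩ := hC
  rcases ha with ha | ha <;> rcases he with he | he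
  · exact Or.inl (ha.symm.trans he)
  · exact Or.inr (ha.symm.trans he)
  · right
    simpa [M.edge_edge] using sameCycle_edge_edge h4 (ha.symm.trans he)
  · left
    simpa [M.edge_edge] using sameCycle_edge_edge h4 (ha.symm.trans he)

theorem IsCentralCircuit.straight_mem (h4 : ∀ d, M.degree d = 4) (hC : M.IsCentralCircuit C) :
    ∀ x ∈ C, M.straight x ∈ C := by
  obtain ⟨d, rfl⟩ := hC
  rintro x (h | h)
  · exact Or.inl (Equiv.Perm.sameCycle_apply_right.2 h)
  · right
    rwa [← Equiv.Perm.sameCycle_apply_right, straight_edge_straight h4]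

theorem IsCentralCircuit.vert_vert_mem (h4 : ∀ d, M.degree d = 4) (hC : M.IsCentralCircuit C) :
    ∀ x ∈ C, M.vert (M.vert x) ∈ C := fun x hx => by
  simpa [straight, M.edge_edge] using hC.straight_mem h4 _ (hC.edge_mem x hx)

theorem IsCentralCircuit.apply_eq {K : Type*} (h4 : ∀ d, M.degree d = 4)
    (hC : M.IsCentralCircuit C) {f : D → K} (hv : ∀ x, f (M.vert x) = f x)
    (he : ∀ x ∈ C, f (M.edge x) = f x) {a b : D} (ha : a ∈ C) (hb : b ∈ C) : f a = f b := by
  have key : ∀ e, M.straight.SameCycle a e → f e = f a := fun e h =>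
    (mem_of_sameCycle (S := {x | x ∈ C ∧ f x = f a})
      (fun x hx => ⟨hC.straight_mem h4 x hx.1, by
        simp only [straight, Equiv.Perm.mul_apply, hv, he x hx.1, hx.2]⟩) h ⟨ha, rfl⟩).2
  rcases hC.sameCycle h4 ha hb with h | h
  · exact (key _ h).symm
  · rw [← he b hb, key _ h]

/-- The dart `face x` lies between `edge x` and `straight x` in the rotation. It is not in `A`, for
otherwise it would form a corner with `edge x`; so the region extends across it. -/
theorem straight_mem_region (h4 : ∀ d, M.degree d = 4) {A : Set D} {d : D}
    (hA : ∀ x ∈ A, M.edge x ∈ A) (hflat : ∀ x ∈ M.region A d, x ∈ A → M.vert x ∉ A) {x : D}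
    (hx : x ∈ M.region A d) (hxA : x ∈ A) : M.straight x ∈ M.region A d := by
  rw [← vert_inv_vert_inv_edge h4, vert_inv_edge]
  refine vert_inv_mem_region (face_mem_region hx) fun h => ?_
  refine hflat _ (face_mem_region hx) h ?_
  rw [M.vert_face]
  exact hA x hxA

/-- The region stays on the left of the whole orbit of `a`. At a self-intersection this orbit
contains `x` or `vert (vert x)`, and the next dart in the rotation is also in `C`: a corner. -/
theorem IsCentralCircuit.isSimple (h4 : ∀ d, M.degree d = 4) (hC : M.IsCentralCircuit C)
    {A : Set D} {d : D} (hCA : C ⊆ A) (hA : ∀ x ∈ A, M.edge x ∈ A)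
    (hflat : ∀ x ∈ M.region A d, x ∈ A → M.vert x ∉ A) {a : D} (ha : a ∈ C)
    (haT : a ∈ M.region A d) : M.IsSimple C := by
  have horbit : ∀ e, M.straight.SameCycle a e → e ∈ M.region A d := fun e h =>
    (mem_of_sameCycle (S := M.region A d ∩ C) (fun x hx =>
      ⟨straight_mem_region h4 hA hflat hx.1 (hCA hx.2), hC.straight_mem h4 x hx.2⟩) h ⟨haT, ha⟩).1
  intro x
  by_contra! hx
  have hxC : x ∈ C := hx x (Equiv.Perm.SameCycle.refl _ _)
  rcases hC.sameCycle h4 ha hxC with h | h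
  · exact hflat x (horbit x h) (hCA hxC) (hCA (hx _ (M.sameVertex_vert x)))
  · have h2 : M.straight (M.edge x) = M.vert (M.vert x) := by
      simp [straight, M.edge_edge]
    have h3 : M.SameVertex x (M.vert (M.vert x)) :=
      (M.sameVertex_vert x).trans (M.sameVertex_vert _)
    refine hflat (M.vert (M.vert x)) (h2 ▸ horbit _ (Equiv.Perm.sameCycle_apply_right.2 h))
      (hCA (hx _ h3)) (hCA (hx _ (h3.trans (M.sameVertex_vert _))))

theorem exists_mem_region_of_atVertices (h4 : ∀ d, M.degree d = 4) (hC : M.IsCentralCircuit C)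
    {A : Set D} {d x : D} (hx : x ∈ M.region A d) (hxC : x ∈ M.atVertices C)
    (hxA : x ∈ A → x ∈ C) : ∃ a ∈ C, a ∈ M.region A d := by
  by_cases h : x ∈ C
  · exact ⟨x, h, hx⟩
  · refine ⟨M.vert⁻¹ x, mem_of_apply_mem (σ := M.vert * M.vert) (hC.vert_vert_mem h4) ?_,
      vert_inv_mem_region hx fun hA => h (hxA hA)⟩
    simpa using hxC.resolve_left h

/-- The darts that leave a circuit into an adjacent flat region are permuted by `across`. -/
theorem across_invariant (h4 : ∀ d, M.degree d = 4) (hC : M.IsCentralCircuit C)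
    {A : Set D} {d : D} (hCA : C ⊆ A) (hA : ∀ x ∈ A, M.edge x ∈ A)
    (hsize : ∀ x ∈ M.region A d, M.faceSize x = 4)
    (hflat : ∀ x ∈ M.region A d, x ∈ A → M.vert x ∉ A) :
    ∀ x ∈ {x | x ∈ M.region A d ∧ x ∉ A ∧ M.vert x ∈ C ∧ M.face x ∉ C},
      M.across x ∈ {x | x ∈ M.region A d ∧ x ∉ A ∧ M.vert x ∈ C ∧ M.face x ∉ C} := by
  rintro x ⟨hxT, hxA, hxC, hxF⟩
  -- `b` is the side on `C` of the `4`-gon left of `x`; the opposite side is `face x`, and `across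
  -- x` leaves from the start of `b`.
  set b := M.edge (M.vert x) with hb
  have hbC : b ∈ C := hC.edge_mem _ hxC
  have hbx : M.face b = x := by rw [hb, face_edge]; simp
  have hbT : b ∈ M.region A d :=
    mem_of_apply_mem (σ := M.face) (fun _ => face_mem_region) (hbx.symm ▸ hxT)
  have hac : M.across x = M.vert b := by
    have h : M.face (M.face x) = M.edge (M.vert b) := by
      apply M.face.injective
      rw [face_edge, ← hbx, M.face_face_face_face (hsize b hbT)]
      simp
    simp only [across, Equiv.Perm.mul_apply, h, M.edge_edge]
  have hvb : M.vert b ∉ A := hflat b hbT (hCA hbC)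
  refine ⟨hac ▸ vert_mem_region hA hbT hvb, hac ▸ hvb, hac ▸ hC.vert_vert_mem h4 b hbC, fun h => ?_⟩
  have h2 : M.face (M.across x) = M.straight (M.face x) := by
    rw [← vert_inv_vert_inv_edge h4]
    simp only [across, Equiv.Perm.mul_apply, face_edge, vert_inv_edge]
  rw [h2] at h
  exact hxF (mem_of_apply_mem (hC.straight_mem h4) h)

end Circuits
-- Rings and separation
section Rings

variable {D : Type*} {M : CombMap D} {C : Set D}

/-- Each face has a side on `C` just before the ring dart `x`, while `x` and the opposite side `face
x` are not on `C`. This singles out `x` among the four sides, so the ring enters no face twice. -/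
theorem isRing_of_flat [Finite D] (hC : M.IsCentralCircuit C)
    {A : Set D} {d e : D} (hCA : C ⊆ A)
    (hsize : ∀ x ∈ M.region A d, M.faceSize x = 4)
    (hR : ∀ x ∈ {x | M.across.SameCycle e x},
      x ∈ M.region A d ∧ x ∉ A ∧ M.vert x ∈ C ∧ M.face x ∉ C) :
    M.IsRing {x | M.across.SameCycle e x} := by
  refine ⟨⟨e, rfl⟩, fun x hx => hsize x (hR x hx).1, fun x hx y hy hxy => ?_⟩
  obtain ⟨hxT, hxA, hxC, -⟩ := hR x hx
  obtain ⟨-, hyA, hyC, hyF⟩ := hR y hy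
  have hx4 := M.face_face_face_face (hsize x hxT)
  have hx3 : M.face (M.face (M.face x)) = M.edge (M.vert x) := by
    apply M.face.injective
    rw [hx4, face_edge]
    simp
  have hx3C : M.face (M.face (M.face x)) ∈ C := hx3 ▸ hC.edge_mem _ hxC
  have hcases : y ∈ {y | y = x ∨ y = M.face x ∨ y = M.face (M.face x) ∨
      y = M.face (M.face (M.face x))} := by
    refine mem_of_sameCycle ?_ hxy (Or.inl rfl)
    rintro z (rfl | rfl | rfl | rfl)
    · exact Or.inr (Or.inl rfl)
    · exact Or.inr (Or.inr (Or.inl rfl))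
    · exact Or.inr (Or.inr (Or.inr rfl))
    · exact Or.inl hx4
  rcases hcases with rfl | rfl | rfl | rfl
  · rfl
  · rw [M.vert_face] at hyC
    exact absurd (hCA (by simpa [M.edge_edge] using hC.edge_mem _ hyC)) hxA
  · exact absurd hx3C hyF
  · exact absurd (hCA hx3C) hyA

-- Each passage of the ring through a face enters by `x` and leaves by `face (face x)`, so its two
-- contributions to that face cancel mod `2`.
open Classical in
theorem sum_ring_mul_eq_zero [Fintype D] (e : D) {h : D → ZMod 2}
    (hh : ∀ x, h (M.face x) = h x) :
    ∑ x, ((if M.across.SameCycle e x then 1 else 0) +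
      (if M.across.SameCycle e (M.edge x) then 1 else 0)) * h x = 0 := by
  have h2 : ∑ x, (if M.across.SameCycle e (M.edge x) then 1 else 0) * h x =
      ∑ x, (if M.across.SameCycle e x then 1 else 0) * h x := by
    rw [← Equiv.sum_comp (M.face * M.face)]
    refine Finset.sum_congr rfl fun x _ => ?_
    have h3 : M.edge (M.face (M.face x)) = M.across x := rfl
    simp only [Equiv.Perm.mul_apply, hh, h3, Equiv.Perm.sameCycle_apply_right]
  simp only [add_mul, Finset.sum_add_distrib]
  rw [h2, CharTwo.add_self_eq_zero]

/-- In a plane graph, the two ends of an edge shared by consecutive faces of a ring have different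
values of a function that is constant on the components of the complement of the ring. -/
theorem exists_ring_potential [Fintype D] (hM : M.IsPlane) (e : D)
    (hR : ∀ x, M.across.SameCycle e x → ¬ M.across.SameCycle e (M.edge x)) :
    ∃ f : D → ZMod 2, (∀ x, f (M.vert x) = f x) ∧
      (∀ x, M.across.SameCycle e x → f (M.edge x) ≠ f x) ∧
      ∀ x, ¬ M.across.SameCycle e x → ¬ M.across.SameCycle e (M.edge x) →
        f (M.edge x) = f x := by
  classical
  obtain ⟨f, hfv, hf⟩ := exists_potential M hM
    (r := fun x => (if M.across.SameCycle e x then 1 else 0) +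
      (if M.across.SameCycle e (M.edge x) then 1 else 0))
    (fun x => by rw [M.edge_edge, add_comm]) (fun h hh => sum_ring_mul_eq_zero e hh)
  refine ⟨f, hfv, fun x hx h => ?_, fun x hx hx' => ?_⟩
  · have h1 := hf x
    rw [if_pos hx, if_neg (hR x hx), h, CharTwo.add_self_eq_zero] at h1
    simp at h1
  · have h1 := hf x
    rw [if_neg hx, if_neg hx', add_zero] at h1
    exact (CharTwo.add_eq_zero.1 h1).symm

theorem DisjointCircuits.isSimple_and_exists_ring [Finite D] {i : ℕ} (hM : M.IsHedrite i)
    {C₁ C₂ : Set D} (h₁ : M.IsCentralCircuit C₁) (h₂ : M.IsCentralCircuit C₂)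
    (hdis : M.DisjointCircuits C₁ C₂) :
    M.IsSimple C₁ ∧ M.IsSimple C₂ ∧ ∃ R : Set D, M.IsRing R ∧ M.Separates R C₁ C₂ := by
  have := Fintype.ofFinite D
  have h4 := hM.fourValent
  have hs : ∀ d, M.faceSize d ≤ 4 := fun d => by
    have := hM.faceSize_mem d
    omega
  have h1e := h₁.edge_mem
  have h2e := h₂.edge_mem
  have h1v := h₁.vert_vert_mem h4
  have h2v := h₂.vert_vert_mem h4
  have hV : ∀ x ∈ M.atVertices C₁, x ∉ M.atVertices C₂ := fun x hx1 hx2 => by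
    obtain ⟨y, hy, hxy⟩ := sameVertex_of_atVertices hx1
    obtain ⟨z, hz, hxz⟩ := sameVertex_of_atVertices hx2
    exact hdis y hy z hz (hxy.symm.trans hxz)
  set A := C₁ ∪ C₂ with hAdef
  have hA : ∀ x ∈ A, M.edge x ∈ A := fun x hx => hx.imp (h1e x) (h2e x)
  obtain ⟨c₁, hc₁⟩ : ∃ x, x ∈ C₁ := by
    obtain ⟨d, rfl⟩ := h₁
    exact ⟨d, Or.inl (Equiv.Perm.SameCycle.refl _ _)⟩
  obtain ⟨c₂, hc₂⟩ : ∃ x, x ∈ C₂ := by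
    obtain ⟨d, rfl⟩ := h₂
    exact ⟨d, Or.inl (Equiv.Perm.SameCycle.refl _ _)⟩
  obtain ⟨e₀, he₀, e₁, he₁, hpath⟩ := exists_reflTransGen_between
    (V₁ := M.atVertices C₁) (V₂ := M.atVertices C₂) (hM.isPlane.1.2 c₁ c₂).reflTransGen
    (Or.inl hc₁) (Or.inl hc₂)
  have hregion : ∀ y, Relation.ReflTransGen (fun x y => x ∉ M.atVertices C₂ ∧
      y ∉ M.atVertices C₁ ∧ (y = M.vert x ∨ y = M.edge x)) e₀ y → y ∈ M.region A e₀ := by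
    intro y hy
    induction hy with
    | refl => exact self_mem_region
    | @tail y z _ hyz ih =>
      obtain ⟨hy2, hz1, rfl | rfl⟩ := hyz
      · exact vert_mem_region hA ih fun h =>
          h.elim (fun h => hz1 (Or.inl h)) fun h => hy2 (Or.inr h)
      · exact edge_mem_region ih fun h =>
          h.elim (fun h => hz1 (Or.inl (h1e _ h))) fun h => hy2 (Or.inl h)
  have he₁T := hregion e₁ hpath
  obtain ⟨hsize, hflat⟩ := flat_of_disjoint h4 hs h1e h2e h1v h2v hV he₀ he₁T he₁
  obtain ⟨a₁, ha₁, ha₁T⟩ := exists_mem_region_of_atVertices h4 h₁ (A := A) self_mem_region he₀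
    (fun h => h.resolve_right fun h => hV _ he₀ (Or.inl h))
  obtain ⟨a₂, ha₂, ha₂T⟩ := exists_mem_region_of_atVertices h4 h₂ (A := A) he₁T he₁
    (fun h => h.resolve_left fun h => hV _ (Or.inl h) he₁)
  refine ⟨h₁.isSimple h4 Set.subset_union_left hA hflat ha₁ ha₁T,
    h₂.isSimple h4 Set.subset_union_right hA hflat ha₂ ha₂T,
    {x | M.across.SameCycle e₀ x}, ?_⟩
  -- A rotation step would stay at a vertex of `C₁`, so the path starts by traversing `e₀`, which
  -- will be a ring edge.
  obtain ⟨hstart, hrest⟩ : M.edge e₀ ∉ M.atVertices C₁ ∧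
      Relation.ReflTransGen (fun x y => x ∉ M.atVertices C₂ ∧
        y ∉ M.atVertices C₁ ∧ (y = M.vert x ∨ y = M.edge x)) (M.edge e₀) e₁ := by
    rcases Relation.ReflTransGen.cases_head hpath with rfl | ⟨q, ⟨-, hq, rfl | rfl⟩, hrest⟩
    · exact absurd he₁ (hV _ he₀)
    · exact absurd (vert_mem_atVertices h1v _ he₀) hq
    · exact ⟨hq, hrest⟩
  have he₀C : e₀ ∉ C₁ := fun h => hstart (Or.inl (h1e _ h))
  have hR : ∀ x ∈ {x | M.across.SameCycle e₀ x},
      x ∈ M.region A e₀ ∧ x ∉ A ∧ M.vert x ∈ C₁ ∧ M.face x ∉ C₁ := fun x hx => by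
    refine mem_of_sameCycle
      (across_invariant h4 h₁ Set.subset_union_left hA hsize hflat) hx ⟨self_mem_region, ?_, ?_, ?_⟩
    · exact fun h => h.elim he₀C fun h => hV _ he₀ (Or.inl h)
    · exact he₀.resolve_left he₀C
    · intro h
      refine hstart ?_
      rw [← M.vert_face]
      exact vert_mem_atVertices h1v _ (Or.inl h)
  refine ⟨isRing_of_flat h₁ Set.subset_union_left hsize hR,
    fun x hx hxR => (hR x hxR).2.1 hx, fun d hd e he hde => ?_⟩
  obtain ⟨f, hfv, hfR, hf⟩ := exists_ring_potential hM.isPlane e₀ fun x hx hx' => by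
    refine (hR _ hx').2.2.2 ?_
    rw [face_edge]
    refine mem_of_apply_mem (σ := M.vert * M.vert) h1v ?_
    simpa using (hR x hx).2.2.1
  have hfA : ∀ x ∈ A, f (M.edge x) = f x := fun x hx =>
    hf x (fun h => (hR x h).2.1 hx) fun h => (hR _ h).2.1 (hA x hx)
  have hf₁ : f d = f (M.vert e₀) :=
    h₁.apply_eq h4 hfv (fun x hx => hfA x (Or.inl hx)) hd (he₀.resolve_left he₀C)
  have hf₂ : f e = f e₁ := by
    rcases he₁ with h | h
    · exact h₂.apply_eq h4 hfv (fun x hx => hfA x (Or.inr hx)) he h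
    · rw [← hfv e₁]
      exact h₂.apply_eq h4 hfv (fun x hx => hfA x (Or.inr hx)) he h
  have hfde : f d = f e := hde.apply_eq hfv hf
  -- Every ring dart starts at a vertex of `C₁`; beyond `e₀` the path avoids these vertices, so the
  -- potential no longer changes.
  have hfrest : ∀ y, Relation.ReflTransGen (fun x y => x ∉ M.atVertices C₂ ∧
      y ∉ M.atVertices C₁ ∧ (y = M.vert x ∨ y = M.edge x)) (M.edge e₀) y →
      y ∉ M.atVertices C₁ ∧ f y = f (M.edge e₀) := by
    intro y hy
    induction hy with
    | refl => exact ⟨hstart, rfl⟩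
    | @tail y z _ hyz ih =>
      obtain ⟨-, hz1, rfl | rfl⟩ := hyz
      · exact ⟨hz1, by rw [hfv, ih.2]⟩
      · exact ⟨hz1, by
          rw [hf y (fun h => ih.1 (Or.inr (hR _ h).2.2.1)) fun h => hz1 (Or.inr (hR _ h).2.2.1),
            ih.2]⟩
  refine hfR e₀ (Equiv.Perm.SameCycle.refl _ _) ?_
  rw [← (hfrest e₁ hrest).2, ← hf₂, ← hfde, hf₁, hfv]

end Rings
end CombMap

theorem mainTheorem9 {D : Type*} [Finite D] (M : CombMap D) (i : ℕ) (hM : M.IsHedrite i)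
    (C₁ C₂ : Set D) (h₁ : M.IsCentralCircuit C₁) (h₂ : M.IsCentralCircuit C₂) :
    M.DisjointCircuits C₁ C₂ ↔
      M.IsSimple C₁ ∧ M.IsSimple C₂ ∧ ∃ R : Set D, M.IsRing R ∧ M.Separates R C₁ C₂ := by
  refine ⟨fun h => h.isSimple_and_exists_ring hM h₁ h₂, ?_⟩
  rintro ⟨-, -, R, -, -, hR⟩ d hd e he hde
  exact hR d hd e he (Relation.ReflTransGen.single (Or.inl hde))
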